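/- **Proposition.** $\mathsf{Almost\mbox{-}EC}\equiv_{\mathrm W}(\mathsf C_{\mathbb N}\to\lim)$, where the notions are as follows. *Represented spaces.* A represented space is a set $X$ with a partial surjection $\delta_X:\subseteq\mathbb N^{\mathbb N}\to X$; $p$ is a name of $\delta_X(p)$. Here $\mathbb N^{\mathbb N}$ is represented by the identity, $\mathbb N$ by $p\mapsto p(0)$, and $X\times Y$ by $\langle p,q\rangle\mapsto(\delta_X(p),\delta_Y(q))$, where $\langle p,q\rangle$ is the interleaving of $p$ and $q$. $\mathcal A(\mathbb N)$ is the space of closed subsets $A$ of the discrete space $\mathbb N$, a name of $A$ being an enumeration of $\mathbb N\setminus A$; $\mathcal O(\mathbb N)$ is the space of open subsets $U$ of $\mathbb N$, a name of $U$ being an enumeration of $U$ (in an enumeration, an entry $n+1$ lists $n$ and an entry $0$ lists nothing, so that the listed set may be empty). *Multi-valued functions.* A partial multi-valued function $f:\subseteq X\rightrightarrows Y$ is a relation; $f(x)$ is the set of $y$ related to $x$, and $\operatorname{dom}(f)=\{x: f(x)\neq\emptyset\}$. By definition, $z\in(f\circ g)(x)$ if and only if $g(x)\subseteq\operatorname{dom}(f)$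 and $z\in f(y)$ for some $y\in g(x)$. *Weihrauch reducibility.* A partial function $F:\subseteq\mathbb N^{\mathbb N}\to\mathbb N^{\mathbb N}$ realizes $f$ if, whenever $p$ is a name of some $x\in\operatorname{dom}(f)$, $F(p)$ is defined and is a name of some $y\in f(x)$. $f\leq_{\mathrm W}g$ means that there are computable $K,H:\subseteq\mathbb N^{\mathbb N}\to\mathbb N^{\mathbb N}$ such that $p\mapsto K\langle p,G(H(p))\rangle$ realizes $f$ for every realizer $G$ of $g$; $f\equiv_{\mathrm W}g$ means $f\leq_{\mathrm W}g$ and $g\leq_{\mathrm W}f$. *Strongly continuous multi-valued functions.* For $p\in\mathbb N^{\mathbb N}$ let $\Phi_p:\subseteq\mathbb N^{\mathbb N}\to\mathbb N^{\mathbb N}$ be the partial function computed by a fixed universal type-two machine on inputs $\langle p,q\rangle$ (defined at $q$ if and only if infinitely many symbols are output). Let $\Phi_p^{X,Y}:\subseteq X\rightrightarrows Y$ be such that $x\in\operatorname{dom}(\Phi^{X,Y}_p)$ if and only if $\delta_Y(\Phi_p\langle q,r\rangle)$ is defined for all names $q$ of $x$ and all $r\in\mathbb N^{\mathbb N}$,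 and then $\Phi_p^{X,Y}(x)$ is the set of all these values. $\mathcal M(X,Y)$ is the set of all $\Phi_p^{X,Y}$, $p\in\mathbb N^{\mathbb N}$, where $p$ is a name of $\Phi_p^{X,Y}$. *Implication.* For $f:\subseteq U\rightrightarrows V$ and $g:\subseteq X\rightrightarrows Y$ with $\operatorname{dom}(g)\neq\emptyset$ or $\operatorname{dom}(f)=\emptyset$, the multi-valued function $(g\to f):\subseteq U\rightrightarrows\mathcal M(Y,V)\times X$ is given by $(H,x)\in(g\to f)(u)$ if and only if $x\in\operatorname{dom}(H\circ g)$ and $(H\circ g)(x)\subseteq f(u)$. *The problems.* $\mathsf C_{\mathbb N}:\subseteq\mathcal A(\mathbb N)\rightrightarrows\mathbb N$, $A\mapsto A$, is defined on the non-empty sets. $\lim:\subseteq\mathbb N^{\mathbb N}\to\mathbb N^{\mathbb N}$ is $\lim(p)(n)=\lim_{i\to\infty}p(\langle n,i\rangle)$, defined if all these limits exist, where $\langle n,i\rangle$ is a computable pairing of natural numbers. $\mathsf{Almost\mbox{-}EC}:\mathcal A(\mathbb N)\rightrightarrows\mathcal O(\mathbb N)$ has as values at $A$ all $U$ such that $(A\setminus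 U)\cup(U\setminus A)$ is finite. -/

import Mathlib

namespace Weihrauch

/-! ### Baire space and type-two computability -/

/-- Baire space `ℕ^ℕ`. -/
abbrev Baire : Type := ℕ → ℕ

/-- The standard pairing on Baire space, `⟨p, q⟩ = p(0) q(0) p(1) q(1) …`. -/
def pair (p q : Baire) : Baire := fun n => if n % 2 = 0 then p (n / 2) else q (n / 2)

/-- First projection of the pairing on Baire space. -/
def left (r : Baire) : Baire := fun n => r (2 * n)

/-- Second projection of the pairing on Baire space. -/
def right (r : Baire) : Baire := fun n => r (2 * n + 1)

theorem left_pair (p q : Baire) : left (pair p q) = p := by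
  funext n
  simp [left, pair]

theorem right_pair (p q : Baire) : right (pair p q) = q := by
  funext n
  have h1 : (2 * n + 1) % 2 = 1 := by omega
  have h2 : (2 * n + 1) / 2 = n := by omega
  simp [right, pair, h1, h2]

/-- The finite prefix `r(0) … r(l - 1)`. -/
def initSeg (r : Baire) (l : ℕ) : List ℕ := (List.range l).map r

/-- The machine with program `c` and the infinite input `r`: the symbol in position `n` of the
output tape. For `k = 0, 1, 2, …` with `k = ⟨s, l⟩`, the program `c` is run for `s` steps on the
finite prefix of length `l` of `r` together with `n`; the first result that appears is written.
If none ever appears, position `n` remains blank. -/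
def machine (c : Nat.Partrec.Code) (r : Baire) (n : ℕ) : Part ℕ :=
  Nat.rfindOpt fun k =>
    Nat.Partrec.Code.evaln k.unpair.1 c (Encodable.encode (initSeg r k.unpair.2, n))

/-- The universal functional `Φ_p`: on input `q`, the universal machine reads from `p(0)` which
program is to be run on `⟨p, q⟩`. `Φ_p(q)` is defined if and only if every position of the output
tape gets written, and then it is the sequence on that tape. -/
def Phi (p : Baire) : Baire →. Baire := fun q =>
  ⟨∀ n, (machine (Denumerable.ofNat Nat.Partrec.Code (p 0)) (pair p q) n).Dom,
    fun h n => (machine (Denumerable.ofNat Nat.Partrec.Code (p 0)) (pair p q) n).get (h n)⟩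

/-- A partial function on Baire space is computable if, on its domain, it is given by `Φ_p` for
some computable `p`. -/
def ComputableFun (F : Baire →. Baire) : Prop :=
  ∃ p : Baire, Computable p ∧ ∀ q, ∀ r ∈ F q, r ∈ Phi p q

/-! ### Represented spaces and multi-valued functions -/

/-- A represented space: a set with a partial surjection from Baire space onto it. -/
structure RepSpace where
  /-- the underlying set -/
  carrier : Type
  /-- the representation; `x ∈ rep p` says that `p` is a name of `x` -/
  rep : Baire →. carrier
  rep_surj : ∀ x, ∃ p, x ∈ rep p

/-- A partial multi-valued function `f :⊆ X ⇉ Y`, given by its graph. -/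
def MultiFun (X Y : RepSpace) : Type := X.carrier → Set Y.carrier

/-- The domain of a multi-valued function. -/
def MultiFun.dom {X Y : RepSpace} (f : MultiFun X Y) : Set X.carrier := {x | (f x).Nonempty}

/-- Composition `f ∘ g` of multi-valued functions: `z ∈ (f ∘ g)(x)` if and only if
`g(x) ⊆ dom(f)` and `z ∈ f(y)` for some `y ∈ g(x)`. -/
def MultiFun.comp {X Y Z : RepSpace} (f : MultiFun Y Z) (g : MultiFun X Y) : MultiFun X Z :=
  fun x => {z | (∀ y ∈ g x, y ∈ f.dom) ∧ ∃ y ∈ g x, z ∈ f y}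

/-- `F` is a realizer of `f`. -/
def Realizes {X Y : RepSpace} (F : Baire →. Baire) (f : MultiFun X Y) : Prop :=
  ∀ p, ∀ x ∈ X.rep p, x ∈ f.dom → ∃ q ∈ F p, ∃ y ∈ Y.rep q, y ∈ f x

/-- Weihrauch reducibility: there are computable `K, H :⊆ ℕ^ℕ → ℕ^ℕ` such that `K⟨id, GH⟩`
realizes `f` for every realizer `G` of `g`. -/
def Reducible {X Y U V : RepSpace} (f : MultiFun X Y) (g : MultiFun U V) : Prop :=
  ∃ K H : Baire →. Baire, ComputableFun K ∧ ComputableFun H ∧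
    ∀ G : Baire →. Baire, Realizes G g →
      Realizes (fun p => (H p).bind fun s => (G s).bind fun t => K (pair p t)) f

/-- Weihrauch equivalence. -/
def Equivalent {X Y U V : RepSpace} (f : MultiFun X Y) (g : MultiFun U V) : Prop :=
  Reducible f g ∧ Reducible g f

/-! ### Constructions of represented spaces -/

/-- Baire space, represented by the identity. -/
def baireSpace : RepSpace where
  carrier := Baire
  rep := fun p => Part.some p
  rep_surj := fun x => ⟨x, Part.mem_some x⟩

/-- The natural numbers, `p` being a name of `p(0)`. -/
def natSpace : RepSpace where
  carrier := ℕ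
  rep := fun p => Part.some (p 0)
  rep_surj := fun x => ⟨fun _ => x, Part.mem_some x⟩

/-- The product: `⟨p, q⟩` is a name of `(x, y)` if `p` is one of `x` and `q` is one of `y`. -/
def prodSpace (X Y : RepSpace) : RepSpace where
  carrier := X.carrier × Y.carrier
  rep := fun r => (X.rep (left r)).bind fun x => (Y.rep (right r)).map fun y => (x, y)
  rep_surj := by
    rintro ⟨x, y⟩
    obtain ⟨p, hp⟩ := X.rep_surj x
    obtain ⟨q, hq⟩ := Y.rep_surj y
    refine ⟨pair p q, ?_⟩
    rw [left_pair, right_pair]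
    exact Part.mem_bind_iff.2 ⟨x, hp, (Part.mem_map_iff _).2 ⟨y, hq, rfl⟩⟩

open Classical in
/-- The closed subsets of the discrete space `ℕ`, represented by negative information: a name of
`A` enumerates the complement of `A` (the entry `n + 1` lists `n`, the entry `0` lists nothing). -/
def closedSpace : RepSpace where
  carrier := TopologicalSpace.Closeds ℕ
  rep := fun p => Part.some ⟨{n | ∀ k, p k ≠ n + 1}, isClosed_discrete _⟩
  rep_surj := by
    intro A
    refine ⟨fun k => if k ∈ A then 0 else k + 1, ?_⟩
    rw [Part.mem_some_iff]
    ext n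
    change n ∈ A ↔ ∀ k, (if k ∈ A then 0 else k + 1) ≠ n + 1
    constructor
    · intro hn k hk
      split_ifs at hk with h
      obtain rfl : k = n := by omega
      exact h hn
    · intro h
      by_contra hn
      exact h n (by simp [hn])

open Classical in
/-- The open subsets of the discrete space `ℕ`, represented by positive information: a name of
`U` enumerates `U` (the entry `n + 1` lists `n`, the entry `0` lists nothing). -/
def openSpace : RepSpace where
  carrier := TopologicalSpace.Opens ℕ
  rep := fun p => Part.some ⟨{n | ∃ k, p k = n + 1}, isOpen_discrete _⟩
  rep_surj := by
    intro U
    refine ⟨fun k => if k ∈ U then k + 1 else 0, ?_⟩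
    rw [Part.mem_some_iff]
    ext n
    change n ∈ U ↔ ∃ k, (if k ∈ U then k + 1 else 0) = n + 1
    constructor
    · intro hn
      exact ⟨n, by simp [hn]⟩
    · rintro ⟨k, hk⟩
      split_ifs at hk with h
      obtain rfl : k = n := by omega
      exact h

/-- `Φ_p^{X,Y} = δ_Y ∘ Φ_p ∘ (δ_X^cyl)⁻¹`, where `⟨q, r⟩` is a `δ_X^cyl`-name of `x` if and only
if `q` is a `δ_X`-name of `x`. -/
def PhiMulti (X Y : RepSpace) (p : Baire) : MultiFun X Y := fun x =>
  {y | (∀ q, x ∈ X.rep q → ∀ r, ∃ s ∈ Phi p (pair q r), (Y.rep s).Dom) ∧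
    ∃ q, x ∈ X.rep q ∧ ∃ r, ∃ s ∈ Phi p (pair q r), y ∈ Y.rep s}

/-- The represented space `M(X, Y)` of strongly continuous multi-valued functions, those of the
form `Φ_p^{X,Y}`; every `p` is a name of `Φ_p^{X,Y}`. -/
def multiSpace (X Y : RepSpace) : RepSpace where
  carrier := {f : MultiFun X Y // ∃ p, f = PhiMulti X Y p}
  rep := fun p => Part.some ⟨PhiMulti X Y p, p, rfl⟩
  rep_surj := by
    rintro ⟨f, p, rfl⟩
    exact ⟨p, Part.mem_some _⟩

/-- The implication `(g → f) :⊆ U ⇉ M(Y, V) × X` for `f :⊆ U ⇉ V` and `g :⊆ X ⇉ Y`, in the case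
that `dom(g) ≠ ∅` or `dom(f) = ∅` (in the remaining case `(g → f)` is the artificial top degree,
not a multi-valued function). The solutions for `u` are the pairs `(H, x)` such that `H ∘ g` is
defined at `x` and `(H ∘ g)(x) ⊆ f(u)`. -/
def implication {U V X Y : RepSpace} (g : MultiFun X Y) (f : MultiFun U V)
    (_h : g.dom.Nonempty ∨ f.dom = ∅) : MultiFun U (prodSpace (multiSpace Y V) X) := fun u =>
  {w | w.2 ∈ (MultiFun.comp w.1.1 g).dom ∧ MultiFun.comp w.1.1 g w.2 ⊆ f u}

/-! ### The problems -/

/-- Closed choice `C_ℕ`: find an element of a non-empty closed set. -/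
def closedChoiceNat : MultiFun closedSpace natSpace :=
  fun A : TopologicalSpace.Closeds ℕ => {n : ℕ | n ∈ A}

theorem closedChoiceNat_dom_nonempty : closedChoiceNat.dom.Nonempty :=
  ⟨(⊤ : TopologicalSpace.Closeds ℕ), (0 : ℕ), Set.mem_univ (0 : ℕ)⟩

/-- `lim :⊆ ℕ^ℕ → ℕ^ℕ`, `lim(p)(n) = lim_{i → ∞} p(⟨n, i⟩)`, defined where all these limits
exist. -/
def limMap : MultiFun baireSpace baireSpace := fun p : Baire =>
  {q : Baire | ∀ n, Filter.Tendsto (fun i => p (Nat.pair n i)) Filter.atTop (nhds (q n))}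

/-- Given a closed `A ⊆ ℕ`, find an open `U ⊆ ℕ` such that `(A ∖ U) ∪ (U ∖ A)` is finite. -/
def almostEC : MultiFun closedSpace openSpace :=
  fun A : TopologicalSpace.Closeds ℕ =>
    {U : TopologicalSpace.Opens ℕ | (((A : Set ℕ) \ U) ∪ ((U : Set ℕ) \ A)).Finite}

end Weihrauch

namespace Weihrauch

/-! ### Programs for functionals on Baire space -/

/-! To reduce `(C_ℕ → lim)` to `almostEC`, let `u` converge row by row. A position `⟨n, k⟩` is
unstable as soon as one later change in row `n` is seen, so the stable positions form a closed set
with a name computable from `u`. Let `t` enumerate a set that differs from it finitely. Some bound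
`b` exceeds all unstable positions listed by `t`, and every row still has listed positions beyond
`b`. Given such a `b`, the limit in row `n` is the value of `u` at any listed position of that row
that is at least `b`. An unsuitable `b` is refuted by one listed unstable position, so `C_ℕ` can
find a suitable one (`forall_refutedBounds_ne`, `exists_code_listed_value`).

Conversely, the characteristic function of `A` is a limit computable from a name of `A`. A solution
`⟨h, y⟩` of the implication computes it from any number `b` that `y` never lists. Stage by stage,
the least number not yet listed is taken as a guess for `b`, and each stage handles one number `m`,
listing it if `Φ_h` at the guess has answered `1`. The guess is eventually constant and correct
(`eventually_leastUnlisted_iff`), so only the finitely many numbers handled by early stages can be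
treated wrongly (`finite_listsAt_ne`). -/

theorem initSeg_length (r : Baire) (l : ℕ) : (initSeg r l).length = l := by
  simp [initSeg]

theorem initSeg_getD (r : Baire) {i l : ℕ} (h : i < l) : (initSeg r l).getD i 0 = r i := by
  simp [initSeg, h]

theorem pair_even (p q : Baire) (n : ℕ) : pair p q (2 * n) = p n :=
  congrFun (left_pair p q) n

theorem pair_odd (p q : Baire) (n : ℕ) : pair p q (2 * n + 1) = q n :=
  congrFun (right_pair p q) n

/-- Every primitive recursive function `f` on finite prefixes is implemented by a program: if `f`
finds a value on some prefix of `r`, then the machine writes one of the values found by `f`. -/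
theorem exists_code_machine (f : List ℕ → ℕ → Option ℕ) (hf : Primrec₂ f) :
    ∃ c : Nat.Partrec.Code, ∀ (r : Baire) (n : ℕ), (∃ l w, f (initSeg r l) n = some w) →
      ∃ v ∈ machine c r n, ∃ l, f (initSeg r l) n = some v := by
  obtain ⟨c, hc⟩ := Nat.Partrec.Code.exists_code.1
    (Partrec.nat_iff.1 ((Computable.ofOption hf.to_comp).comp
      (Computable.ofNat (List ℕ × ℕ))))
  have hev : ∀ L n, c.eval (Encodable.encode (L, n)) = (f L n : Part ℕ) := by
    intro L n
    rw [hc]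
    simp
  refine ⟨c, fun r n ⟨l, w, hw⟩ => ?_⟩
  have hmem : w ∈ c.eval (Encodable.encode (initSeg r l, n)) := by
    rw [hev, hw]
    exact Part.mem_some w
  obtain ⟨s, hs⟩ := Nat.Partrec.Code.evaln_complete.1 hmem
  -- Attempt `⟨s, l⟩` succeeds, but an earlier one may win on another prefix; hence only some value
  -- of `f` is promised.
  have hdom : (machine c r n).Dom :=
    Nat.rfindOpt_dom.2 ⟨Nat.pair s l, w, by simpa using hs⟩
  refine ⟨_, Part.get_mem hdom, ?_⟩
  obtain ⟨k, hk⟩ := Nat.rfindOpt_spec (Part.get_mem hdom)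
  refine ⟨k.unpair.2, ?_⟩
  have := Nat.Partrec.Code.evaln_sound hk
  rw [hev] at this
  simpa using this

theorem mem_Phi {p q r : Baire} :
    r ∈ Phi p q ↔
      ∀ n, r n ∈ machine (Denumerable.ofNat Nat.Partrec.Code (p 0)) (pair p q) n := by
  constructor
  · rintro ⟨h, rfl⟩ n
    exact Part.get_mem (h n)
  · intro h
    exact ⟨fun n => (h n).fst, funext fun n => Part.get_eq_of_mem (h n) (h n).fst⟩

/-- The odd-numbered entries of a list. -/
def oddEntries (L : List ℕ) : List ℕ :=
  (List.range (L.length / 2)).map fun i => L.getD (2 * i + 1) 0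

theorem oddEntries_initSeg (p q : Baire) (l : ℕ) :
    oddEntries (initSeg (pair p q) l) = initSeg q (l / 2) := by
  rw [oddEntries, initSeg_length]
  refine List.map_congr_left fun i hi => ?_
  rw [List.mem_range] at hi
  rw [initSeg_getD _ (by omega), pair_odd]

theorem primrec_oddEntries : Primrec oddEntries := by
  refine Primrec.list_map (Primrec.list_range.comp
    (Primrec.nat_div.comp Primrec.list_length (Primrec.const 2))) ?_
  exact (Primrec.list_getD 0).comp Primrec.fst
    (Primrec.nat_add.comp (Primrec.nat_mul.comp (Primrec.const 2) Primrec.snd) (Primrec.const 1))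

/-- A total functional with a primitive recursive modulus of continuity that is primitive recursive
on finite prefixes (extended by `0`) is computable. -/
theorem computableFun_of_primrec {F : Baire → Baire} {B : ℕ → ℕ}
    (hF : Primrec₂ fun (L : List ℕ) n => F (fun i => L.getD i 0) n) (hB : Primrec B)
    (hloc : ∀ q q' n, (∀ i < B n, q i = q' i) → F q n = F q' n) :
    ComputableFun fun q => Part.some (F q) := by
  obtain ⟨c, hc⟩ := exists_code_machine
    -- The tape interleaves the name of the program with `q`, so `2 * B n` symbols are needed to see
    -- `B n` entries of `q`.
    (fun L n => if 2 * B n ≤ L.length then some (F (fun i => (oddEntries L).getD i 0) n)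
      else none) (by
      refine Primrec.ite ?_ ?_ (Primrec.const none)
      · exact Primrec.nat_le.comp (Primrec.nat_mul.comp (Primrec.const 2) (hB.comp Primrec.snd))
          (Primrec.list_length.comp Primrec.fst)
      · exact Primrec.option_some.comp
          (hF.comp (primrec_oddEntries.comp Primrec.fst) Primrec.snd))
  refine ⟨fun _ => Encodable.encode c, Computable.const _, fun q r hr => ?_⟩
  rw [Part.mem_some_iff] at hr
  subst hr
  rw [mem_Phi]
  intro n
  set R := pair (fun _ => Encodable.encode c) q
  obtain ⟨v, hv, l, hl⟩ := hc R n ⟨2 * B n, _, by rw [initSeg_length, if_pos le_rfl]⟩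
  rw [initSeg_length, oddEntries_initSeg] at hl
  split_ifs at hl with hlen
  rw [hloc _ q n fun i hi => initSeg_getD q (by omega), Option.some_inj] at hl
  simpa [hl] using hv

/-! ### Closure properties of primitive recursive predicates -/

theorem primrecPred_forall_lt {α : Type*} [Primcodable α] {R : α → ℕ → Prop} {b : α → ℕ}
    (hR : PrimrecRel R) (hb : Primrec b) : PrimrecPred fun a => ∀ x < b a, R a x :=
  ((PrimrecRel.forall_mem_list (R := fun x a => R a x) (hR.comp Primrec.snd Primrec.fst)).comp
    (Primrec.list_range.comp hb) Primrec.id).of_eq (by simp)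

theorem primrecPred_exists_lt {α : Type*} [Primcodable α] {R : α → ℕ → Prop} {b : α → ℕ}
    (hR : PrimrecRel R) (hb : Primrec b) : PrimrecPred fun a => ∃ x < b a, R a x :=
  ((PrimrecRel.exists_mem_list (R := fun x a => R a x) (hR.comp Primrec.snd Primrec.fst)).comp
    (Primrec.list_range.comp hb) Primrec.id).of_eq (by simp)

theorem primrec_fst_unpair {α : Type*} [Primcodable α] {f : α → ℕ} (hf : Primrec f) :
    Primrec fun a => (f a).unpair.1 :=
  Primrec.fst.comp (Primrec.unpair.comp hf)

theorem primrec_snd_unpair {α : Type*} [Primcodable α] {f : α → ℕ} (hf : Primrec f) :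
    Primrec fun a => (f a).unpair.2 :=
  Primrec.snd.comp (Primrec.unpair.comp hf)

/-- The affine functions with natural coefficients are primitive recursive. -/
theorem primrec_affine {α : Type*} [Primcodable α] (a b : ℕ) {f : α → ℕ} (hf : Primrec f) :
    Primrec fun x => a * f x + b :=
  Primrec.nat_add.comp (Primrec.nat_mul.comp (Primrec.const a) hf) (Primrec.const b)

theorem primrec_getD {α : Type*} [Primcodable α] {L : α → List ℕ} {f : α → ℕ}
    (hL : Primrec L) (hf : Primrec f) : Primrec fun x => (L x).getD (f x) 0 :=
  (Primrec.list_getD 0).comp hL hf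

/-! ### Stable positions of a convergent double sequence -/

/-- The position `z'` is in the same row as `z`, not to the left of it, and `u` has another value
there. -/
def Changes (u : ℕ → ℕ) (z z' : ℕ) : Prop :=
  z.unpair.1 = z'.unpair.1 ∧ z.unpair.2 ≤ z'.unpair.2 ∧ u z' ≠ u z

instance (u : ℕ → ℕ) (z z' : ℕ) : Decidable (Changes u z z') :=
  inferInstanceAs (Decidable (_ ∧ _ ∧ _))

theorem changes_congr {u u' : ℕ → ℕ} {z z' : ℕ} (h : u z = u' z) (h' : u z' = u' z') :
    Changes u z z' ↔ Changes u' z z' := by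
  rw [Changes, Changes, h, h']

theorem primrecPred_changes {α : Type*} [Primcodable α] {u : α → ℕ → ℕ} {z z' : α → ℕ}
    (hu : Primrec₂ u) (hz : Primrec z) (hz' : Primrec z') :
    PrimrecPred fun a => Changes (u a) (z a) (z' a) :=
  (Primrec.eq.comp (primrec_fst_unpair hz) (primrec_fst_unpair hz')).and
    ((Primrec.nat_le.comp (primrec_snd_unpair hz) (primrec_snd_unpair hz')).and
      (Primrec.eq.comp (hu.comp Primrec.id hz') (hu.comp Primrec.id hz)).not)

/-- A position is stable if the row of `u` is constant from there on. -/
def Stable (u : ℕ → ℕ) (z : ℕ) : Prop := ∀ z', ¬ Changes u z z'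

theorem Stable.eq_limit {u v : Baire} (h : v ∈ limMap u) {z : ℕ} (hz : Stable u z) :
    u z = v z.unpair.1 := by
  refine tendsto_nhds_unique (tendsto_const_nhds.congr' ?_) (h z.unpair.1)
  filter_upwards [Filter.eventually_ge_atTop z.unpair.2] with i hi
  by_contra hne
  exact hz (Nat.pair z.unpair.1 i) ⟨by simp, by simpa using hi, fun e => hne e.symm⟩

theorem eventually_stable {u v : Baire} (h : v ∈ limMap u) (n : ℕ) :
    ∀ᶠ k in Filter.atTop, Stable u (Nat.pair n k) := by
  have hev := h n
  rw [nhds_discrete, Filter.tendsto_pure, Filter.eventually_atTop] at hev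
  obtain ⟨k₀, hk₀⟩ := hev
  filter_upwards [Filter.eventually_ge_atTop k₀] with k hk
  rintro z' ⟨h1, h2, h3⟩
  rw [Nat.unpair_pair] at h1 h2
  apply h3
  rw [hk₀ k hk, ← Nat.pair_unpair z', ← h1]
  exact hk₀ _ (hk.trans h2)

/-- An enumeration of the positions that are not stable. -/
def unstablePositions (u : Baire) : Baire := fun j =>
  if Changes u j.unpair.1 j.unpair.2 then j.unpair.1 + 1 else 0

/-- One later change witnesses instability, so `unstablePositions u` is a name of the closed set of
stable positions. -/
theorem forall_unstablePositions_ne {u : Baire} {z : ℕ} :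
    (∀ j, unstablePositions u j ≠ z + 1) ↔ Stable u z := by
  constructor
  · intro h z' hz'
    exact h (Nat.pair z z') (by simp [unstablePositions, hz'])
  · intro h j hj
    rw [unstablePositions] at hj
    split_ifs at hj with hc
    obtain rfl : j.unpair.1 = z := by omega
    exact h _ hc

theorem computableFun_unstablePositions :
    ComputableFun fun u => Part.some (unstablePositions u) := by
  refine computableFun_of_primrec (B := fun j => 1 * j + 1) ?_ (primrec_affine 1 1 Primrec.id) ?_
  · have h1 : Primrec fun x : List ℕ × ℕ => x.2.unpair.1 := primrec_fst_unpair Primrec.snd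
    refine Primrec.ite (primrecPred_changes ?_ h1 (primrec_snd_unpair Primrec.snd))
      (Primrec.succ.comp h1) (Primrec.const 0)
    exact primrec_getD (Primrec.fst.comp Primrec.fst) Primrec.snd
  · intro q q' j h
    have h1 := j.unpair_left_le
    have h2 := j.unpair_right_le
    simp only [unstablePositions,
      changes_congr (h j.unpair.1 (by omega)) (h j.unpair.2 (by omega))]

/-! ### The limit from an almost correct enumeration of the stable positions -/

/-- For `q = ⟨u, t⟩`, an enumeration of all `b` such that `t` lists some unstable position of `u`
that is at least `b`. -/
def refutedBounds (q : Baire) : Baire := fun i =>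
  if q (2 * i.unpair.1.unpair.1 + 1) = i.unpair.1.unpair.2 + 1 ∧
      i.unpair.2.unpair.1 ≤ i.unpair.1.unpair.2 ∧
      Changes (fun k => q (2 * k)) i.unpair.1.unpair.2 i.unpair.2.unpair.2
  then i.unpair.2.unpair.1 + 1 else 0

/-- A refutation of `b` is a finite witness `i = ⟨⟨s, m⟩, ⟨b, z'⟩⟩`: entry `s` of `t` lists some `m
≥ b`, and `u` changes between `m` and `z'`. -/
theorem forall_refutedBounds_ne {u t : Baire} {b : ℕ} :
    (∀ i, refutedBounds (pair u t) i ≠ b + 1) ↔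
      ∀ s m, t s = m + 1 → b ≤ m → Stable u m := by
  have hu : (fun k => pair u t (2 * k)) = u := funext (pair_even u t)
  constructor
  · intro h s m hs hb z' hz'
    exact h (Nat.pair (Nat.pair s m) (Nat.pair b z'))
      (by simp [refutedBounds, pair_odd, hs, hb, hu, hz'])
  · intro h i hi
    rw [refutedBounds, hu, pair_odd] at hi
    split_ifs at hi with hc
    obtain rfl : i.unpair.2.unpair.1 = b := by omega
    exact h _ _ hc.1 hc.2.1 _ hc.2.2

theorem primrec_refutedBounds {α : Type*} [Primcodable α] {q : α → Baire} {i : α → ℕ}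
    (hq : Primrec₂ q) (hi : Primrec i) : Primrec fun a => refutedBounds (q a) (i a) := by
  have h1 := primrec_fst_unpair (primrec_fst_unpair hi)
  have h2 := primrec_snd_unpair (primrec_fst_unpair hi)
  have h3 := primrec_fst_unpair (primrec_snd_unpair hi)
  have h4 := primrec_snd_unpair (primrec_snd_unpair hi)
  refine Primrec.ite (PrimrecPred.and ?_ (PrimrecPred.and ?_ ?_)) (Primrec.succ.comp h3)
    (Primrec.const 0)
  · exact Primrec.eq.comp (hq.comp Primrec.id (primrec_affine 2 1 h1)) (Primrec.succ.comp h2)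
  · exact Primrec.nat_le.comp h3 h2
  · exact primrecPred_changes
      (hq.comp Primrec.fst (Primrec.nat_mul.comp (Primrec.const 2) Primrec.snd)) h2 h4

theorem refutedBounds_congr {q q' : Baire} {i : ℕ} (h : ∀ k < 2 * i + 2, q k = q' k) :
    refutedBounds q i = refutedBounds q' i := by
  have h1 := i.unpair_left_le
  have h2 := i.unpair_right_le
  have h3 := i.unpair.1.unpair_left_le
  have h4 := i.unpair.1.unpair_right_le
  have h5 := i.unpair.2.unpair_right_le
  simp only [refutedBounds, h (2 * i.unpair.1.unpair.1 + 1) (by omega),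
    changes_congr (u := fun k => q (2 * k)) (u' := fun k => q' (2 * k))
      (h (2 * i.unpair.1.unpair.2) (by omega)) (h (2 * i.unpair.2.unpair.2) (by omega))]

/-- The sequence with first entry `c`, continued by `q`. -/
def consSeq (c : ℕ) (q : Baire) : Baire := fun n => if n = 0 then c else q (n - 1)

theorem consSeq_zero (c : ℕ) (q : Baire) : consSeq c q 0 = c := rfl

theorem consSeq_succ (c : ℕ) (q : Baire) (n : ℕ) : consSeq c q (n + 1) = q n := rfl

/-- This is the outer functional `K` of the first reduction: the program `c` with `⟨u, t⟩` stored
behind it, paired with a name of the set of suitable bounds. -/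
theorem computableFun_pair_consSeq_refutedBounds (c : ℕ) :
    ComputableFun fun q => Part.some (pair (consSeq c q) (refutedBounds q)) := by
  refine computableFun_of_primrec (B := fun n => 1 * n + 2) ?_ (primrec_affine 1 2 Primrec.id) ?_
  · have hhalf : Primrec fun x : List ℕ × ℕ => x.2 / 2 :=
      Primrec.nat_div.comp Primrec.snd (Primrec.const 2)
    refine Primrec.ite (Primrec.eq.comp (Primrec.nat_mod.comp Primrec.snd (Primrec.const 2))
      (Primrec.const 0)) (Primrec.ite (Primrec.eq.comp hhalf (Primrec.const 0)) (Primrec.const c)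
        (primrec_getD Primrec.fst (Primrec.nat_sub.comp hhalf (Primrec.const 1))))
        (primrec_refutedBounds (primrec_getD (Primrec.fst.comp Primrec.fst) Primrec.snd) hhalf)
  · intro q q' n h
    simp only [pair, consSeq]
    rw [h (n / 2 - 1) (by omega)]
    split_ifs with h0 h1
    · rfl
    · rfl
    · exact refutedBounds_congr fun k hk => h k (by omega)

/-- A program that, from a name `h = c u(0) t(0) u(1) t(1) …` and a number `b`, finds in position
`n` the value of `u` at some position in row `n` that is listed by `t` and at least `b`. -/
theorem exists_code_listed_value :
    ∃ c : Nat.Partrec.Code, ∀ (u t x : Baire) (a n : ℕ),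
      (∃ s m, t s = m + 1 ∧ x 0 ≤ m ∧ m.unpair.1 = n) →
      ∃ v ∈ machine c (pair (consSeq a (pair u t)) x) n,
        ∃ s m, t s = m + 1 ∧ x 0 ≤ m ∧ m.unpair.1 = n ∧ v = u m := by
  obtain ⟨c, hc⟩ := exists_code_machine
    (fun L n =>
      -- The length of the prefix codes the candidate `⟨⟨s, m⟩, _⟩`. On the tape, `x 0` is at `1`,
      -- `u m` at `4 * m + 2` and `t s` at `4 * s + 4`.
      if 4 * L.length.unpair.1.unpair.1 + 5 ≤ L.length ∧
        4 * L.length.unpair.1.unpair.2 + 5 ≤ L.length ∧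
        L.getD (4 * L.length.unpair.1.unpair.1 + 4) 0 = L.length.unpair.1.unpair.2 + 1 ∧
        L.getD 1 0 ≤ L.length.unpair.1.unpair.2 ∧
        L.length.unpair.1.unpair.2.unpair.1 = n
      then some (L.getD (4 * L.length.unpair.1.unpair.2 + 2) 0) else none) (by
    have hl : Primrec fun x : List ℕ × ℕ => x.1.length := Primrec.list_length.comp Primrec.fst
    have h1 := primrec_fst_unpair (primrec_fst_unpair hl)
    have h2 := primrec_snd_unpair (primrec_fst_unpair hl)
    refine Primrec.ite (PrimrecPred.and ?_ (PrimrecPred.and ?_ (PrimrecPred.and ?_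
      (PrimrecPred.and ?_ ?_)))) ?_ (Primrec.const none)
    · exact Primrec.nat_le.comp (primrec_affine 4 5 h1) hl
    · exact Primrec.nat_le.comp (primrec_affine 4 5 h2) hl
    · exact Primrec.eq.comp (primrec_getD Primrec.fst (primrec_affine 4 4 h1))
        (Primrec.succ.comp h2)
    · exact Primrec.nat_le.comp (primrec_getD Primrec.fst (Primrec.const 1)) h2
    · exact Primrec.eq.comp (primrec_fst_unpair h2) Primrec.snd
    · exact Primrec.option_some.comp (primrec_getD Primrec.fst (primrec_affine 4 2 h2)))
  refine ⟨c, fun u t x a n => ?_⟩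
  have hR1 : pair (consSeq a (pair u t)) x 1 = x 0 := pair_odd _ _ 0
  have hRu : ∀ m, pair (consSeq a (pair u t)) x (4 * m + 2) = u m := by
    intro m
    rw [show 4 * m + 2 = 2 * (2 * m + 1) by ring, pair_even, consSeq_succ, pair_even]
  have hRt : ∀ s, pair (consSeq a (pair u t)) x (4 * s + 4) = t s := by
    intro s
    rw [show 4 * s + 4 = 2 * (2 * s + 1 + 1) by ring, pair_even, consSeq_succ, pair_odd]
  rintro ⟨s, m, hs, hb, hm⟩
  obtain ⟨v, hv, l, hl⟩ := hc (pair (consSeq a (pair u t)) x) n (by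
    -- The free last component pads the prefix until it contains all the positions read.
    have hle := Nat.right_le_pair (Nat.pair s m) (4 * s + 4 * m + 5)
    refine ⟨Nat.pair (Nat.pair s m) (4 * s + 4 * m + 5), u m, ?_⟩
    rw [initSeg_length]
    simp only [Nat.unpair_pair]
    rw [initSeg_getD _ (by omega), initSeg_getD _ (by omega), initSeg_getD _ (by omega), hRt, hRu,
      hR1, if_pos ⟨by omega, by omega, hs, hb, hm⟩])
  refine ⟨v, hv, ?_⟩
  rw [initSeg_length] at hl
  split_ifs at hl with hcond
  obtain ⟨h1, h2, h3, h4, h5⟩ := hcond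
  rw [initSeg_getD _ (by omega), hRt] at h3
  rw [initSeg_getD _ (by omega), hR1] at h4
  rw [initSeg_getD _ (by omega), hRu, Option.some_inj] at hl
  exact ⟨_, _, h3, h4, h5, hl.symm⟩

/-! ### Solutions of the implication -/

/-- Since `⟨q, r⟩` and `q` have the same entry at `0`, the hypothesis covers every name of `b` with
every auxiliary `r`. -/
theorem phiMulti_natSpace_baireSpace {h : Baire} {b : ℕ} {S : Set Baire}
    (hS : ∀ x : Baire, x 0 = b → ∃ s ∈ Phi h x, s ∈ S) :
    (∃ v, v ∈ PhiMulti natSpace baireSpace h b) ∧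
      ∀ v, v ∈ PhiMulti natSpace baireSpace h b → v ∈ S := by
  constructor
  · obtain ⟨s, hs, -⟩ := hS (pair (fun _ => b) fun _ => 0) rfl
    refine ⟨s, fun q hq r => ?_, fun _ => b, Part.mem_some b, fun _ => 0, s, hs, Part.mem_some s⟩
    obtain ⟨s', hs', -⟩ := hS (pair q r) (Part.mem_some_iff.1 hq).symm
    exact ⟨s', hs', trivial⟩
  · rintro v ⟨-, q, hq, r, s, hs, hv⟩
    obtain ⟨s', hs', hS'⟩ := hS (pair q r) (Part.mem_some_iff.1 hq).symm
    obtain rfl := Part.mem_unique hs hs'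
    obtain rfl := Part.mem_some_iff.1 hv
    exact hS'

/-- If `y` is a name of a non-empty closed set and `Φ_h` maps all names of its elements to the limit
of `u`, then `⟨h, y⟩` is a name of a solution of `(C_ℕ → lim)` at `u`. -/
theorem exists_mem_implication {u h y : Baire}
    (hdom : closedChoiceNat.dom.Nonempty ∨ limMap.dom = ∅)
    (hne : ∃ b, ∀ k, y k ≠ b + 1)
    (hS : ∀ x : Baire, (∀ k, y k ≠ x 0 + 1) → ∃ s ∈ Phi h x, s ∈ limMap u) :
    ∃ w ∈ (prodSpace (multiSpace natSpace baireSpace) closedSpace).rep (pair h y),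
      w ∈ implication closedChoiceNat limMap hdom u := by
  let x : TopologicalSpace.Closeds ℕ := ⟨{n | ∀ k, y k ≠ n + 1}, isClosed_discrete _⟩
  have key : ∀ b : ℕ, b ∈ x → (∃ v, v ∈ PhiMulti natSpace baireSpace h b) ∧
      ∀ v, v ∈ PhiMulti natSpace baireSpace h b → v ∈ limMap u := fun b hb =>
    phiMulti_natSpace_baireSpace fun x hx => hS x (by rw [hx]; exact hb)
  refine ⟨(⟨PhiMulti natSpace baireSpace h, h, rfl⟩, x), ?_, ?_, ?_⟩
  · refine Part.mem_bind_iff.2 ⟨⟨PhiMulti natSpace baireSpace h, h, rfl⟩, ?_,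
      (Part.mem_map_iff _).2 ⟨x, ?_, rfl⟩⟩
    · rw [left_pair]
      exact Part.mem_some _
    · rw [right_pair]
      exact Part.mem_some _
  · obtain ⟨b, hb⟩ := hne
    obtain ⟨v, hv⟩ := (key b hb).1
    exact ⟨v, fun b' hb' => (key b' hb').1, b, hb, hv⟩
  · rintro v ⟨-, b, hb, hv⟩
    exact (key b hb).2 v hv

/-- A solution of `(C_ℕ → lim)` at `u` named by `t` consists of a non-empty closed set and of a
functional that maps the names of all its elements to the limit of `u`. -/
theorem spec_of_mem_implication {u t : Baire}
    {hdom : closedChoiceNat.dom.Nonempty ∨ limMap.dom = ∅}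
    {w : (prodSpace (multiSpace natSpace baireSpace) closedSpace).carrier}
    (hw : w ∈ (prodSpace (multiSpace natSpace baireSpace) closedSpace).rep t)
    (hwu : w ∈ implication closedChoiceNat limMap hdom u) :
    (∃ b, ∀ k, right t k ≠ b + 1) ∧
      ∀ b, (∀ k, right t k ≠ b + 1) → ∀ r, ∃ s ∈ Phi (left t) (pair (fun _ => b) r),
        s ∈ limMap u := by
  obtain ⟨H, hH, hx⟩ := Part.mem_bind_iff.1 hw
  obtain ⟨x', hx', rfl⟩ := (Part.mem_map_iff _).1 hx
  obtain rfl := Part.mem_some_iff.1 hH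
  obtain rfl := Part.mem_some_iff.1 hx'
  obtain ⟨⟨v, hall, b, hb, hv⟩, hsub⟩ := hwu
  refine ⟨⟨b, hb⟩, fun b' hb' r => ?_⟩
  -- The domain clause of the composition gives definedness at every element of the closed set, not
  -- just at `b`.
  obtain ⟨v', hv'⟩ := hall b' hb'
  obtain ⟨s, hs, -⟩ := hv'.1 (fun _ => b') (Part.mem_some b') r
  refine ⟨s, hs, hsub ⟨hall, b', hb', hv'.1, fun _ => b', Part.mem_some b', r, s, hs,
    Part.mem_some s⟩⟩

/-! ### The reduction of the implication to `almostEC` -/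

theorem almostEC_dom : almostEC.dom = Set.univ := by
  refine Set.eq_univ_of_forall fun A => ?_
  change TopologicalSpace.Closeds ℕ at A
  refine ⟨(⟨(A : Set ℕ), isOpen_discrete _⟩ : TopologicalSpace.Opens ℕ), ?_⟩
  change (((A : Set ℕ) \ A) ∪ ((A : Set ℕ) \ A)).Finite
  simp

theorem exists_bound_stable {u t : Baire}
    (hfin : {m | ¬ (Stable u m ↔ ∃ s, t s = m + 1)}.Finite) :
    ∃ b, ∀ s m, t s = m + 1 → b ≤ m → Stable u m := by
  obtain ⟨b, hb⟩ := hfin.bddAbove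
  refine ⟨b + 1, fun s m hs hm => ?_⟩
  by_contra hst
  have : m ≤ b := hb fun h => hst (h.2 ⟨s, hs⟩)
  omega

/-- A row contains infinitely many stable positions and `t` misses only finitely many of them. Hence
the search succeeds for every bound. -/
theorem exists_listed_in_row {u t v : Baire} (hv : v ∈ limMap u)
    (hfin : {m | ¬ (Stable u m ↔ ∃ s, t s = m + 1)}.Finite) (b n : ℕ) :
    ∃ s m, t s = m + 1 ∧ b ≤ m ∧ m.unpair.1 = n := by
  obtain ⟨b', hb'⟩ := hfin.bddAbove
  obtain ⟨k, hk, hkb⟩ :=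
    ((eventually_stable hv n).and (Filter.eventually_ge_atTop (b + b' + 1))).exists
  have hle := Nat.right_le_pair n k
  have hiff : Stable u (Nat.pair n k) ↔ ∃ s, t s = Nat.pair n k + 1 := by
    by_contra h
    have : Nat.pair n k ≤ b' := hb' h
    omega
  obtain ⟨s, hs⟩ := hiff.1 hk
  exact ⟨s, _, hs, by omega, by simp⟩

theorem implication_limMap_reducible_almostEC
    (hdom : closedChoiceNat.dom.Nonempty ∨ limMap.dom = ∅) :
    Reducible (implication closedChoiceNat limMap hdom) almostEC := by
  obtain ⟨c, hc⟩ := exists_code_listed_value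
  refine ⟨_, _, computableFun_pair_consSeq_refutedBounds (Encodable.encode c),
    computableFun_unstablePositions, fun G hG (p : Baire) (u : Baire) hp hu => ?_⟩
  obtain rfl : u = p := Part.mem_some_iff.1 hp
  obtain ⟨w, ⟨(v : Baire), hv⟩, hwu⟩ := hu
  -- Any solution computes a value of `lim` at `u`, so `u` converges.
  replace hv : v ∈ limMap u := hwu hv
  obtain ⟨t, ht, U, hU, hUA⟩ := hG (unstablePositions u) _ (Part.mem_some _)
    (by rw [almostEC_dom]; trivial)
  obtain rfl := Part.mem_some_iff.1 hU
  have hfin : {m | ¬ (Stable u m ↔ ∃ s, t s = m + 1)}.Finite := by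
    refine Set.Finite.subset hUA fun m hm => ?_
    change (((∀ j, unstablePositions u j ≠ m + 1) ∧ ¬ ∃ s, t s = m + 1) ∨
      ((∃ s, t s = m + 1) ∧ ¬ ∀ j, unstablePositions u j ≠ m + 1))
    rw [forall_unstablePositions_ne]
    replace hm : ¬ (Stable u m ↔ ∃ s, t s = m + 1) := hm
    tauto
  refine ⟨_, Part.mem_bind_iff.2 ⟨_, Part.mem_some _, Part.mem_bind_iff.2
    ⟨t, ht, Part.mem_some _⟩⟩, exists_mem_implication hdom ?_ ?_⟩
  · obtain ⟨b, hb⟩ := exists_bound_stable hfin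
    exact ⟨b, forall_refutedBounds_ne.2 hb⟩
  · intro x hx
    rw [forall_refutedBounds_ne] at hx
    refine ⟨v, mem_Phi.2 fun n => ?_, hv⟩
    rw [consSeq_zero, Denumerable.ofNat_encode]
    obtain ⟨y, hy, s, m, hs, hm, rfl, rfl⟩ := hc u t x (Encodable.encode c) n
      (exists_listed_in_row hv hfin (x 0) n)
    rwa [← (hx s m hs hm).eq_limit hv]

/-! ### The characteristic function of a closed set as a limit -/

/-- In row `m`, this sequence is `1` until `p` lists `m`, and `0` from then on. -/
def notYetListed (p : Baire) : Baire := fun j =>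
  if ∃ i < j.unpair.2, p i = j.unpair.1 + 1 then 0 else 1

theorem computableFun_notYetListed : ComputableFun fun p => Part.some (notYetListed p) := by
  refine computableFun_of_primrec (B := id) ?_ Primrec.id ?_
  · refine Primrec.ite (primrecPred_exists_lt ?_ (primrec_snd_unpair Primrec.snd))
      (Primrec.const 0) (Primrec.const 1)
    exact Primrec.eq.comp (primrec_getD (Primrec.fst.comp Primrec.fst) Primrec.snd)
      (Primrec.succ.comp (primrec_fst_unpair (Primrec.snd.comp Primrec.fst)))
  · intro q q' j h
    have hj := j.unpair_right_le
    have hiff : (∃ i < j.unpair.2, q i = j.unpair.1 + 1) ↔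
        ∃ i < j.unpair.2, q' i = j.unpair.1 + 1 :=
      exists_congr fun i => and_congr_right fun hi => by rw [h i (hi.trans_le hj)]
    simp only [notYetListed, hiff]

open Classical in
theorem limMap_notYetListed (p : Baire) :
    (fun m => if ∃ i, p i = m + 1 then 0 else 1 : Baire) ∈ limMap (notYetListed p) := by
  intro m
  refine tendsto_const_nhds.congr' ?_
  by_cases hm : ∃ i, p i = m + 1
  · obtain ⟨i, hi⟩ := hm
    filter_upwards [Filter.eventually_gt_atTop i] with k hk
    have h' : ∃ i < k, p i = m + 1 := ⟨i, hk, hi⟩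
    have h : ∃ i, p i = m + 1 := ⟨i, hi⟩
    simp [notYetListed, h, h']
  · refine Filter.Eventually.of_forall fun k => ?_
    have h' : ¬ ∃ i < k, p i = m + 1 := fun ⟨i, _, hi⟩ => hm ⟨i, hi⟩
    simp only [notYetListed, Nat.unpair_pair, if_neg hm, if_neg h']

theorem exists_code_tail :
    ∃ c : Nat.Partrec.Code, ∀ (a : ℕ) (v x : Baire) (n : ℕ),
      v n ∈ machine c (pair (consSeq a v) x) n := by
  obtain ⟨c, hc⟩ := exists_code_machine
    (fun L n => if 2 * n + 3 ≤ L.length then some (L.getD (2 * n + 2) 0) else none) (by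
    refine Primrec.ite (Primrec.nat_le.comp (primrec_affine 2 3 Primrec.snd)
      (Primrec.list_length.comp Primrec.fst)) ?_ (Primrec.const none)
    exact Primrec.option_some.comp (primrec_getD Primrec.fst (primrec_affine 2 2 Primrec.snd)))
  refine ⟨c, fun a v x n => ?_⟩
  have hR : pair (consSeq a v) x (2 * n + 2) = v n := by
    rw [show 2 * n + 2 = 2 * (n + 1) by ring, pair_even, consSeq_succ]
  obtain ⟨w, hw, l, hl⟩ := hc (pair (consSeq a v) x) n
    ⟨2 * n + 3, _, by rw [initSeg_length, if_pos le_rfl]⟩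
  rw [initSeg_length] at hl
  split_ifs at hl with hlen
  rw [initSeg_getD _ (by omega), hR, Option.some_inj] at hl
  rwa [hl]

/-- Names of strongly continuous functions may be non-computable: `h` simply stores the limit `v`,
and the zero sequence names the closed set `ℕ`. -/
theorem mem_dom_implication_limMap {u v : Baire} (hv : v ∈ limMap u)
    (hdom : closedChoiceNat.dom.Nonempty ∨ limMap.dom = ∅) :
    u ∈ (implication closedChoiceNat limMap hdom).dom := by
  obtain ⟨c, hc⟩ := exists_code_tail
  obtain ⟨w, -, hw⟩ := exists_mem_implication (u := u) (y := fun _ => 0)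
    (h := consSeq (Encodable.encode c) v) hdom ⟨0, by simp⟩ (fun x _ => ⟨v, mem_Phi.2 fun n => by
      rw [consSeq_zero, Denumerable.ofNat_encode]
      exact hc _ v x n, hv⟩)
  exact ⟨w, hw⟩

/-! ### Simulation of the universal machine -/

theorem primrec_left {α : Type*} [Primcodable α] {p : α → Baire} (hp : Primrec₂ p) :
    Primrec₂ fun a => left (p a) :=
  hp.comp Primrec.fst (Primrec.nat_mul.comp (Primrec.const 2) Primrec.snd)

theorem primrec_right {α : Type*} [Primcodable α] {p : α → Baire} (hp : Primrec₂ p) :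
    Primrec₂ fun a => right (p a) :=
  hp.comp Primrec.fst (primrec_affine 2 1 Primrec.snd)

theorem primrec_pair {α : Type*} [Primcodable α] {p q : α → Baire} (hp : Primrec₂ p)
    (hq : Primrec₂ q) : Primrec₂ fun a => pair (p a) (q a) := by
  have hhalf : Primrec fun x : α × ℕ => x.2 / 2 :=
    Primrec.nat_div.comp Primrec.snd (Primrec.const 2)
  exact Primrec.ite (Primrec.eq.comp (Primrec.nat_mod.comp Primrec.snd (Primrec.const 2))
    (Primrec.const 0)) (hp.comp Primrec.fst hhalf) (hq.comp Primrec.fst hhalf)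

theorem primrec_initSeg {α : Type*} [Primcodable α] {r : α → Baire} {l : α → ℕ}
    (hr : Primrec₂ r) (hl : Primrec l) : Primrec fun a => initSeg (r a) (l a) :=
  Primrec.list_map (Primrec.list_range.comp hl) hr

/-- The result of the `k`-th attempt of the machine to compute the output symbol `m`. -/
def attempt (c : Nat.Partrec.Code) (r : Baire) (m k : ℕ) : Option ℕ :=
  Nat.Partrec.Code.evaln k.unpair.1 c (Encodable.encode (initSeg r k.unpair.2, m))

theorem primrec_attempt {α : Type*} [Primcodable α] {c : α → Nat.Partrec.Code} {r : α → Baire}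
    {m k : α → ℕ} (hc : Primrec c) (hr : Primrec₂ r) (hm : Primrec m) (hk : Primrec k) :
    Primrec fun a => attempt (c a) (r a) (m a) (k a) :=
  Nat.Partrec.Code.primrec_evaln.comp (((primrec_fst_unpair hk).pair hc).pair
    (Primrec.encode.comp ((primrec_initSeg hr (primrec_snd_unpair hk)).pair hm)))

theorem attempt_congr {c : Nat.Partrec.Code} {r r' : Baire} {m k : ℕ}
    (h : ∀ i < k, r i = r' i) : attempt c r m k = attempt c r' m k := by
  have hk := k.unpair_right_le
  have : initSeg r k.unpair.2 = initSeg r' k.unpair.2 :=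
    List.map_congr_left fun i hi => h i ((List.mem_range.1 hi).trans_le hk)
  rw [attempt, attempt, this]

/-- The `k`-th attempt is the first successful one for the output symbol `m`, with result `v`. -/
def FirstResult (c : Nat.Partrec.Code) (r : Baire) (m k v : ℕ) : Prop :=
  attempt c r m k = some v ∧ ∀ k' < k, attempt c r m k' = none

/-- For fixed `k` the right-hand condition is decidable, so it can be tested within one stage. -/
theorem mem_machine_iff {c : Nat.Partrec.Code} {r : Baire} {m v : ℕ} :
    v ∈ machine c r m ↔ ∃ k, FirstResult c r m k v := by
  rw [machine, Nat.rfindOpt, Part.mem_bind_iff]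
  refine exists_congr fun k => ?_
  have hfalse : ∀ o : Option ℕ, false ∈ Part.some o.isSome ↔ o = none := by simp
  have htrue : ∀ o : Option ℕ, true ∈ Part.some o.isSome ↔ o.isSome := by simp
  constructor
  · rintro ⟨hk, hv⟩
    exact ⟨Part.mem_ofOption.1 hv, fun k' hk' => (hfalse _).1 ((Nat.mem_rfind.1 hk).2 hk')⟩
  · rintro ⟨hv, h⟩
    exact ⟨Nat.mem_rfind.2 ⟨(htrue _).2 (Option.isSome_iff_exists.2 ⟨v, hv⟩),
      fun hk' => (hfalse _).2 (h _ hk')⟩, Part.mem_ofOption.2 hv⟩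

theorem firstResult_congr {c : Nat.Partrec.Code} {r r' : Baire} {m k v : ℕ}
    (h : ∀ i < k, r i = r' i) : FirstResult c r m k v ↔ FirstResult c r' m k v := by
  rw [FirstResult, FirstResult, attempt_congr h]
  exact and_congr_right fun _ => forall_congr' fun k' => imp_congr_right fun hk' => by
    rw [attempt_congr fun i hi => h i (hi.trans hk')]

theorem primrecPred_firstResult {α : Type*} [Primcodable α] {c : α → Nat.Partrec.Code}
    {r : α → Baire} {m k v : α → ℕ} (hc : Primrec c) (hr : Primrec₂ r) (hm : Primrec m)
    (hk : Primrec k) (hv : Primrec v) :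
    PrimrecPred fun a => FirstResult (c a) (r a) (m a) (k a) (v a) := by
  refine PrimrecPred.and (Primrec.eq.comp (primrec_attempt hc hr hm hk)
    (Primrec.option_some.comp hv)) (primrecPred_forall_lt ?_ hk)
  exact Primrec.eq.comp (primrec_attempt (hc.comp Primrec.fst)
    (hr.comp (Primrec.fst.comp Primrec.fst) Primrec.snd) (hm.comp Primrec.fst) Primrec.snd)
    (Primrec.const none)

/-! ### The reduction of `almostEC` to the implication -/

/-- `n` is the least number that is not among those listed by the first `j` entries of `y`. -/
def LeastUnlisted (y : Baire) (j n : ℕ) : Prop :=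
  (∀ n' < n, ∃ i < j, y i = n' + 1) ∧ ∀ i < j, y i ≠ n + 1

theorem leastUnlisted_congr {y y' : Baire} {j n : ℕ} (h : ∀ i < j, y i = y' i) :
    LeastUnlisted y j n ↔ LeastUnlisted y' j n := by
  refine and_congr ?_ ?_
  · exact forall₂_congr fun n' _ => exists_congr fun i => and_congr_right fun hi => by rw [h i hi]
  · exact forall₂_congr fun i hi => by rw [h i hi]

theorem primrecPred_leastUnlisted {α : Type*} [Primcodable α] {y : α → Baire} {j n : α → ℕ}
    (hy : Primrec₂ y) (hj : Primrec j) (hn : Primrec n) :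
    PrimrecPred fun a => LeastUnlisted (y a) (j a) (n a) := by
  refine PrimrecPred.and (primrecPred_forall_lt (primrecPred_exists_lt ?_
    (hj.comp Primrec.fst)) hn) (primrecPred_forall_lt (PrimrecPred.not ?_) hj)
  · exact Primrec.eq.comp (hy.comp (Primrec.fst.comp Primrec.fst) Primrec.snd)
      (Primrec.succ.comp (Primrec.snd.comp Primrec.fst))
  · exact Primrec.eq.comp hy (Primrec.succ.comp (hn.comp Primrec.fst))

theorem eventually_leastUnlisted_iff {y : Baire} (h : ∃ b, ∀ k, y k ≠ b + 1) :
    ∃ b, (∀ k, y k ≠ b + 1) ∧ ∃ J, ∀ j ≥ J, ∀ n, LeastUnlisted y j n ↔ n = b := by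
  classical
  have hlisted : ∀ n < Nat.find h, ∃ i, y i = n + 1 := fun n hn => by
    simpa using Nat.find_min h hn
  choose! s hs using hlisted
  -- The threshold lies beyond the entries `s n` that list the numbers below the least unlisted one.
  refine ⟨Nat.find h, Nat.find_spec h, (Finset.range (Nat.find h)).sup s + 1, fun j hj n => ?_⟩
  have hlt : ∀ n < Nat.find h, s n < j := fun n hn => by
    have := Finset.le_sup (f := s) (Finset.mem_range.2 hn)
    omega
  constructor
  · rintro ⟨h1, h2⟩
    by_contra hne
    rcases lt_or_gt_of_ne hne with hlt' | hgt
    · exact h2 _ (hlt n hlt') (hs n hlt')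
    · obtain ⟨i, -, hi⟩ := h1 _ hgt
      exact Nat.find_spec h i hi
  · rintro rfl
    exact ⟨fun n' hn' => ⟨s n', hlt n' hn', hs n' hn'⟩, fun i _ => Nat.find_spec h i⟩

/-- The input of the universal machine that consists of `h` and of a name of the number `b`. -/
def inputAt (h : Baire) (b : ℕ) : Baire := pair h (pair (fun _ => b) fun _ => 0)

/-- The condition under which, for `t = ⟨h, y⟩`, stage `j = ⟨b, ⟨m, k⟩⟩` lists `m`: at this stage
`b` is the least number not listed by `y`, and the `k`-th attempt to compute the symbol `m` of
`Φ_h` at `b` is the first successful one, with result `1`. -/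
def ListsAt (t : Baire) (j : ℕ) : Prop :=
  LeastUnlisted (right t) j j.unpair.1 ∧
    FirstResult (Denumerable.ofNat Nat.Partrec.Code (left t 0)) (inputAt (left t) j.unpair.1)
      j.unpair.2.unpair.1 j.unpair.2.unpair.2 1

/-- The largest position needed is `2 * j - 1`, except that the program `t 0` is read even when `j =
0`. -/
theorem listsAt_congr {t t' : Baire} {j : ℕ} (h : ∀ i < 2 * j + 1, t i = t' i) :
    ListsAt t j ↔ ListsAt t' j := by
  have h1 := j.unpair_right_le
  have h2 := j.unpair.2.unpair_right_le
  refine and_congr (leastUnlisted_congr fun i hi => h _ (by omega)) ?_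
  rw [show left t 0 = left t' 0 from h _ (by omega)]
  refine firstResult_congr fun i hi => ?_
  rw [inputAt, inputAt, pair, pair, show left t (i / 2) = left t' (i / 2) from h _ (by omega)]
  rfl

theorem primrecPred_listsAt {α : Type*} [Primcodable α] {t : α → Baire} {j : α → ℕ}
    (ht : Primrec₂ t) (hj : Primrec j) : PrimrecPred fun a => ListsAt (t a) (j a) := by
  have h1 := primrec_fst_unpair hj
  have h2 := primrec_snd_unpair hj
  refine PrimrecPred.and (primrecPred_leastUnlisted (primrec_right ht) hj h1)
    (primrecPred_firstResult ((Primrec.ofNat _).comp ((primrec_left ht).comp Primrec.id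
      (Primrec.const 0))) ?_ (primrec_fst_unpair h2) (primrec_snd_unpair h2) (Primrec.const 1))
  refine primrec_pair (primrec_left ht) (primrec_pair ?_ (Primrec.const 0))
  exact h1.comp Primrec.fst

open Classical in
/-- The enumeration of the numbers listed according to `ListsAt`, from `⟨p, t⟩`. -/
noncomputable def listedNumbers (q : Baire) : Baire := fun j =>
  if ListsAt (right q) j then j.unpair.2.unpair.1 + 1 else 0

theorem exists_listedNumbers_iff {q : Baire} {m : ℕ} :
    (∃ j, listedNumbers q j = m + 1) ↔ ∃ j, ListsAt (right q) j ∧ j.unpair.2.unpair.1 = m := by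
  simp only [listedNumbers]
  refine exists_congr fun j => ?_
  split_ifs with h <;> simp [h]

theorem computableFun_listedNumbers : ComputableFun fun q => Part.some (listedNumbers q) := by
  classical
  refine computableFun_of_primrec (B := fun j => 4 * j + 2) ?_ (primrec_affine 4 2 Primrec.id) ?_
  · refine Primrec.ite (primrecPred_listsAt (primrec_right ?_) Primrec.snd)
      (Primrec.succ.comp (primrec_fst_unpair (primrec_snd_unpair Primrec.snd))) (Primrec.const 0)
    exact primrec_getD (Primrec.fst.comp Primrec.fst) Primrec.snd
  · intro q q' j h
    have := listsAt_congr (t := right q) (t' := right q') (j := j) fun i hi => h _ (by omega)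
    simp only [listedNumbers, this]

/-- If `Φ_h` maps all names of the elements of the non-empty closed set named by `y` to `s`, then
only finitely many numbers are listed wrongly or missed as elements of `{m | s m = 1}`. -/
theorem finite_listsAt_ne {t s : Baire} (hne : ∃ b, ∀ k, right t k ≠ b + 1)
    (hs : ∀ b, (∀ k, right t k ≠ b + 1) → ∀ r, s ∈ Phi (left t) (pair (fun _ => b) r)) :
    {m | ¬ (s m = 1 ↔ ∃ j, ListsAt t j ∧ j.unpair.2.unpair.1 = m)}.Finite := by
  obtain ⟨b, hb, J, hJ⟩ := eventually_leastUnlisted_iff hne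
  have hmach : ∀ m, s m ∈ machine (Denumerable.ofNat Nat.Partrec.Code (left t 0))
      (inputAt (left t) b) m := mem_Phi.1 (hs b hb fun _ => 0)
  -- Every stage from `J` on has the correct guess `b`, and a stage handles a single number. So an
  -- exceptional `m` must be handled by a stage below `J`.
  refine ((Set.finite_Iio J).image fun j => j.unpair.2.unpair.1).subset fun m hm => ?_
  replace hm : ¬ (s m = 1 ↔ ∃ j, ListsAt t j ∧ j.unpair.2.unpair.1 = m) := hm
  by_contra hsmall
  have hlarge : ∀ j, j.unpair.2.unpair.1 = m → J ≤ j := fun j hj => by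
    by_contra hlt
    exact hsmall ⟨j, not_le.1 hlt, hj⟩
  refine hm ⟨fun h1 => ?_, ?_⟩
  · obtain ⟨k, hk⟩ := mem_machine_iff.1 (hmach m)
    rw [h1] at hk
    have hpos : (Nat.pair b (Nat.pair m k)).unpair.2.unpair.1 = m := by simp
    refine ⟨Nat.pair b (Nat.pair m k), ⟨(hJ _ (hlarge _ hpos) _).2 (by simp), ?_⟩, hpos⟩
    simpa using hk
  · rintro ⟨j, ⟨hleast, hfirst⟩, rfl⟩
    rw [(hJ j (hlarge j rfl) _).1 hleast] at hfirst
    -- The machine is single-valued, so the result `1` found with the correct guess is `s m`.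
    exact Part.mem_unique (hmach _) (mem_machine_iff.2 ⟨_, hfirst⟩)

theorem almostEC_reducible_implication_limMap
    (hdom : closedChoiceNat.dom.Nonempty ∨ limMap.dom = ∅) :
    Reducible almostEC (implication closedChoiceNat limMap hdom) := by
  classical
  refine ⟨_, _, computableFun_listedNumbers, computableFun_notYetListed,
    fun G hG (p : Baire) A hA _ => ?_⟩
  obtain rfl := Part.mem_some_iff.1 hA
  have hlim := limMap_notYetListed p
  set s : Baire := fun m => if ∃ i, p i = m + 1 then 0 else 1 with hsdef
  obtain ⟨t, ht, w, hw, hwu⟩ := hG (notYetListed p) _ (Part.mem_some _)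
    (mem_dom_implication_limMap hlim hdom)
  obtain ⟨hne, hspec⟩ := spec_of_mem_implication hw hwu
  -- By uniqueness of limits, all elements of the closed set yield the same sequence `s`.
  have hfin := finite_listsAt_ne (s := s) hne fun b hb r => by
    obtain ⟨s', hs', hlim'⟩ := hspec b hb r
    rwa [show s = s' from funext fun n => tendsto_nhds_unique (hlim n) (hlim' n)]
  refine ⟨_, Part.mem_bind_iff.2 ⟨_, Part.mem_some _, Part.mem_bind_iff.2
    ⟨t, ht, Part.mem_some _⟩⟩, _, Part.mem_some _, ?_⟩
  refine Set.Finite.subset hfin fun m hm => ?_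
  replace hm : ((∀ j, p j ≠ m + 1) ∧ ¬ ∃ j, listedNumbers (pair p t) j = m + 1) ∨
      ((∃ j, listedNumbers (pair p t) j = m + 1) ∧ ¬ ∀ j, p j ≠ m + 1) := hm
  rw [exists_listedNumbers_iff, right_pair] at hm
  have hs1 : s m = 1 ↔ ∀ j, p j ≠ m + 1 := by
    rw [hsdef]
    simp
  change ¬ (s m = 1 ↔ _)
  rw [hs1]
  rcases hm with ⟨h1, h2⟩ | ⟨h1, h2⟩
  · exact fun h => h2 (h.1 h1)
  · exact fun h => h2 (h.2 h1)

end Weihrauch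

theorem proposition54 :
    Weihrauch.Equivalent Weihrauch.almostEC
      (Weihrauch.implication Weihrauch.closedChoiceNat Weihrauch.limMap
        (Or.inl Weihrauch.closedChoiceNat_dom_nonempty)) :=
  ⟨Weihrauch.almostEC_reducible_implication_limMap _,
    Weihrauch.implication_limMap_reducible_almostEC _⟩
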